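/- For a continuous function $f : X \to \mathbb{R}$, the Reeb space $W_f$ is the quotient space of $X$ obtained by identifying $x_0, x_1$ whenever $f(x_0)=f(x_1)$ and $x_0,x_1$ lie in the same connected component of the level set $f^{-1}(f(x_0))$; $q_f : X \to W_f$ is the quotient map. A (finite) graph is a compact CW complex of dimension at most one, i.e. multiple edges and loops are allowed. A dendrite is a nonempty compact connected locally connected metrizable space that contains no simple closed curve. For every real number $d_1 > 0$ there is a smooth ($C^\infty$) function $F : S^2 \to \mathbb{R}$ on the 2-sphere with $F(S^2) = [-d_1, d_1]$ such that: 1. $F^{-1}(t)$ has exactly two connected components for every $t \in [-d_1, d_1] \setminus \{0\}$; 2. $F^{-1}(0)$ is connected (and non-empty); 3. the Reeb space $W_F$ is a dendrite, but it does not have the structure of a finite graph, i.e. it is not homeomorphic to a finite graph; 4. the set of vertices of $W_F$ is not discrete in the subspace topology, both when the vertices are taken to be the points of $W_F$ that have no open neighbourhood homeomorphic to an open interval, and when they are taken to be the points of $W_F$ that correspond to level set components containing a critical point of $F$. -/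

import Mathlib

open scoped Manifold ContDiff

/-- Two points are equivalent for `f` if they lie in the same connected component of
a common level set of `f`. -/
def reebSetoid {X Y : Type*} [TopologicalSpace X] (f : X → Y) : Setoid X where
  r x y := f x = f y ∧ y ∈ connectedComponentIn (f ⁻¹' {f x}) x
  iseqv :=
    { refl := fun x => ⟨rfl, mem_connectedComponentIn rfl⟩
      symm := by
        rintro x y ⟨hxy, hy⟩
        refine ⟨hxy.symm, ?_⟩
        rw [← hxy, ← connectedComponentIn_eq hy]
        exact mem_connectedComponentIn rfl
      trans := by
        rintro x y z ⟨hxy, hy⟩ ⟨hyz, hz⟩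
        refine ⟨hxy.trans hyz, ?_⟩
        rw [← hxy, ← connectedComponentIn_eq hy] at hz
        exact hz }

/-- The Reeb space of `f`: the space of connected components of the level sets of `f`,
with the quotient topology. -/
abbrev ReebSpace {X Y : Type*} [TopologicalSpace X] (f : X → Y) : Type _ :=
  Quotient (reebSetoid f)

/-- The quotient map from the domain of `f` to the Reeb space of `f`. -/
def reebQuotientMap {X Y : Type*} [TopologicalSpace X] (f : X → Y) : X → ReebSpace f :=
  Quotient.mk (reebSetoid f)

/-- A dendrite: a nonempty, compact, connected, locally connected metrizable space that
contains no simple closed curve. -/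
structure IsDendrite (W : Type*) [TopologicalSpace W] : Prop where
  compact : CompactSpace W
  connected : ConnectedSpace W
  locallyConnected : LocallyConnectedSpace W
  metrizable : TopologicalSpace.MetrizableSpace W
  no_simple_closed_curve : ¬ ∃ γ : Circle → W, Topology.IsEmbedding γ

/-- A space has the structure of a finite graph (multiple edges, loops and isolated vertices
are allowed) if it is Hausdorff and is a CW complex with finitely many cells, all of them of
dimension at most one. -/
def HasFiniteGraphStructure (W : Type*) [TopologicalSpace W] : Prop :=
  T2Space W ∧ ∃ G : Topology.CWComplex (Set.univ : Set W),
    (∀ n, Finite (G.cell n)) ∧ ∀ n, 1 < n → IsEmpty (G.cell n)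

/-- The topological vertices of a space: the points that have no open neighbourhood
homeomorphic to an open interval. -/
def topologicalVertices (W : Type*) [TopologicalSpace W] : Set W :=
  {w | ¬ ∃ U : Set W, IsOpen U ∧ w ∈ U ∧ Nonempty (U ≃ₜ ℝ)}

/-- The unit 2-sphere in Euclidean 3-space. -/
abbrev Sphere2 : Type := Metric.sphere (0 : EuclideanSpace ℝ (Fin 3)) 1

instance factFinrankEuclideanThree :
    Fact (Module.finrank ℝ (EuclideanSpace ℝ (Fin 3)) = 2 + 1) :=
  ⟨by simp⟩

/-- The critical contours of a function on the 2-sphere, as points of its Reeb space: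
the components of level sets that contain a critical point. -/
def criticalContours (F : Sphere2 → ℝ) : Set (ReebSpace F) :=
  {w | ∃ x : Sphere2, mfderiv (𝓡 2) 𝓘(ℝ, ℝ) F x = 0 ∧ reebQuotientMap F x = w}

/-!
The function is built so that its Reeb space is a comb in the plane: a spine, one arm, and teeth
which shrink towards the origin, with height function `(u, v) ↦ u + v`. Let
`s 0 = d₁ > s 1 > s 2 > ⋯` tend to `0`. The spine is `[-d₁, d₁] × 0`, the arm goes down from the
origin to the height `-d₁`, and the tooth with number `k` rises from the point of the spine at
height `s (k + 1)` to the height `s k`. As the heights of the teeth without their feet are the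
disjoint intervals `(s (k + 1), s k]` with union `(0, d₁]`, every level of the comb other than `0`
has exactly two points, and the level `0` has one (`ncard_comb_level`, `comb_level_zero`).

On the sphere take a monotone function of `z` (`spine`) from `-d₁` to `d₁` with plateaus of value
`s (k + 1)` in zones which accumulate at the equator, and one plateau of value `0` below the
equator. Inside each zone add a bump supported in a round cap (`teeth`), of height
`s k - s (k + 1)`, or `-d₁` in the zone of value `0`. The pair of the two functions maps the
sphere onto the comb, and its fibres are connected: they are zones, zones without an open cap, or
zones of a cap (`IsToothLength.isPreconnected_fibre`). For the sum `F` of the two, the image of a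
component of a level set is a connected subset of a level of the comb, which is finite, hence a
point. So the components of level sets are the fibres of the pair, and the Reeb space is the comb
(`FactorsThroughComb.exists_isEmbedding`). `F` is smooth if the lengths of the teeth decrease fast
enough (`exists_summable_forall_contDiff_tsum`), as it is a series of smooth functions with these
lengths as coefficients.

Compactness, connectedness, local connectedness and metrizability of the Reeb space come from the
sphere and from the plane. It contains no simple closed curve, because on such a curve the first
coordinate would be constant or take uncountably many values twice, whereas it takes only
countably many values twice on the comb (`not_exists_circle_embedding`). The tips of the teeth are
topological vertices, since the height is injective near a tip and maximal at it; they are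
infinitely many, but a finite graph has only finitely many topological vertices. They are also
images of critical points, the centres of the caps. Finally, both the set of topological vertices
and the set of critical points are closed, so they contain the limit of the tips, respectively of
the centres, and neither set of vertices is discrete.
-/

open Set Topology Filter

/-! ### Reeb spaces of functions factoring through a map with connected fibres -/

section Factor

variable {X Y Z : Type*} [TopologicalSpace X] [MetricSpace Y]
  {f : X → Z} {g : X → Y} {π : Y → Z}

/-- If `f = π ∘ g`, where the fibres of `g` are connected and `g` takes only finitely many values
on each level set of `f`, then the components of the level sets of `f` are the fibres of `g`: a
connected subset of a finite set is a point. -/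
theorem mem_connectedComponentIn_level_iff (hg : Continuous g) (hf : ∀ x, f x = π (g x))
    (hfib : ∀ c, IsPreconnected (g ⁻¹' {c})) (hfin : ∀ t, (g '' (f ⁻¹' {t})).Finite)
    {x y : X} {t : Z} (hx : f x = t) :
    y ∈ connectedComponentIn (f ⁻¹' {t}) x ↔ g x = g y := by
  constructor
  · intro hy
    have hsub := connectedComponentIn_subset (f ⁻¹' {t}) x
    have hpre : IsPreconnected (g '' connectedComponentIn (f ⁻¹' {t}) x) :=
      isPreconnected_connectedComponentIn.image _ hg.continuousOn
    exact ((hfin t).countable.isTotallyDisconnected) _ (image_mono hsub) hpre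
      (mem_image_of_mem _ (mem_connectedComponentIn hx)) (mem_image_of_mem _ hy)
  · intro hxy
    refine (hfib (g x)).subset_connectedComponentIn rfl ?_ hxy.symm
    intro z hz
    rw [mem_preimage, mem_singleton_iff] at hz ⊢
    rw [hf, hz, ← hf, hx]

theorem reebQuotientMap_eq_iff (hg : Continuous g) (hf : ∀ x, f x = π (g x))
    (hfib : ∀ c, IsPreconnected (g ⁻¹' {c})) (hfin : ∀ t, (g '' (f ⁻¹' {t})).Finite) (x y : X) :
    reebQuotientMap f x = reebQuotientMap f y ↔ g x = g y := by
  rw [reebQuotientMap, Quotient.eq]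
  change (f x = f y ∧ y ∈ connectedComponentIn (f ⁻¹' {f x}) x) ↔ _
  rw [mem_connectedComponentIn_level_iff hg hf hfib hfin rfl, and_iff_right_iff_imp]
  intro h
  rw [hf, hf, h]

theorem card_connectedComponents_level (hg : Continuous g) (hf : ∀ x, f x = π (g x))
    (hfib : ∀ c, IsPreconnected (g ⁻¹' {c})) (hfin : ∀ t, (g '' (f ⁻¹' {t})).Finite) (t : Z) :
    Nat.card (ConnectedComponents (f ⁻¹' {t})) = (g '' (f ⁻¹' {t})).ncard := by
  have key : ∀ x y : f ⁻¹' {t},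
      (x : ConnectedComponents (f ⁻¹' {t})) = y ↔ g x = g y := by
    intro x y
    rw [eq_comm, ConnectedComponents.coe_eq_coe',
      ← mem_connectedComponentIn_level_iff hg hf hfib hfin x.2,
      connectedComponentIn_eq_image x.2]
    exact (Subtype.val_injective.mem_set_image).symm
  rw [← Nat.card_coe_set_eq]
  refine Nat.card_congr (Equiv.ofBijective (Quotient.lift
    (fun x : f ⁻¹' {t} => (⟨g x, mem_image_of_mem g x.2⟩ : g '' (f ⁻¹' {t})))
    fun x y h => Subtype.ext ((key x y).1 (Quotient.sound h))) ⟨?_, ?_⟩)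
  · rintro ⟨x⟩ ⟨y⟩ h
    exact (key x y).2 (congrArg Subtype.val h)
  · rintro ⟨_, x, hx, rfl⟩
    exact ⟨Quotient.mk _ ⟨x, hx⟩, rfl⟩

end Factor

/-! ### Circles in the plane -/

/-- A continuous real function on the circle takes every value strictly between two of its values
at least twice. -/
theorem Circle.exists_ne_of_lt_of_lt {h : Circle → ℝ} (hh : Continuous h) {a b : Circle} {c : ℝ}
    (ha : h a < c) (hb : c < h b) : ∃ x y, x ≠ y ∧ h x = c ∧ h y = c := by
  obtain ⟨p, -, hp⟩ := isPreconnected_univ.intermediate_value (mem_univ a) (mem_univ b)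
    hh.continuousOn ⟨ha.le, hb.le⟩
  have hne : ∀ z, h z ≠ c → z ∈ ({p}ᶜ : Set Circle) := by
    rintro z hz rfl
    exact hz hp
  -- The circle without `p` is still connected, so `c` is taken a second time.
  obtain ⟨q, hq, hqc⟩ := (Circle.isPathConnected_compl_singleton p).isConnected.isPreconnected
    |>.intermediate_value (hne a ha.ne) (hne b hb.ne') hh.continuousOn ⟨ha.le, hb.le⟩
  exact ⟨q, p, hq, hqc, hp⟩

/-- If all but countably many fibres of `u` are points, and `u` and `v` separate points, then the
space contains no simple closed curve: along such a curve `u` would be constant, since otherwise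
it would take uncountably many values at least twice, and then so would `v`. -/
theorem not_exists_circle_embedding {W : Type*} [TopologicalSpace W] {u v : W → ℝ}
    (hu : Continuous u) (hv : Continuous v) (huv : ∀ x y, u x = u y → v x = v y → x = y)
    {S : Set ℝ} (hS : S.Countable) (huS : ∀ x y, u x = u y → u x ∉ S → x = y) :
    ¬ ∃ γ : Circle → W, IsEmbedding γ := by
  rintro ⟨γ, hγ⟩
  have hconst : ∀ a b, u (γ a) = u (γ b) := by
    by_contra! hne
    obtain ⟨a, b, hab⟩ : ∃ a b, u (γ a) < u (γ b) := by
      obtain ⟨a, b, h⟩ := hne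
      exact h.lt_or_gt.elim (fun h => ⟨a, b, h⟩) fun h => ⟨b, a, h⟩
    obtain ⟨c, hc, hcS⟩ : ∃ c ∈ Ioo (u (γ a)) (u (γ b)), c ∉ S := by
      by_contra! hsub
      exact (Cardinal.Real.Ioo_countable_iff.not.2 (not_le.2 hab)) (hS.mono hsub)
    obtain ⟨x, y, hxy, hx, hy⟩ := Circle.exists_ne_of_lt_of_lt (hu.comp hγ.continuous) hc.1 hc.2
    exact hxy (hγ.injective (huS _ _ (hx.trans hy.symm) (by rwa [show u (γ x) = c from hx])))
  have hvinj : ∀ a b, v (γ a) = v (γ b) → a = b := fun a b h =>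
    hγ.injective (huv _ _ (hconst a b) h)
  obtain ⟨a, b, hab⟩ : ∃ a b, v (γ a) < v (γ b) := by
    have h1 : (1 : Circle) ≠ -1 := by
      intro h
      have := congrArg (fun z : Circle => (z : ℂ).re) h
      norm_num at this
    have h2 : v (γ 1) ≠ v (γ (-1)) := fun h => h1 (hvinj _ _ h)
    rcases h2.lt_or_gt with h | h
    exacts [⟨_, _, h⟩, ⟨_, _, h⟩]
  obtain ⟨c, hc⟩ := exists_between hab
  obtain ⟨x, y, hxy, hx, hy⟩ := Circle.exists_ne_of_lt_of_lt (hv.comp hγ.continuous) hc.1 hc.2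
  exact hxy (hvinj _ _ (hx.trans hy.symm))

/-! ### Topological vertices -/

/-- A point near which some continuous real function is injective and maximal at the point is a
topological vertex: an injective continuous function on an open interval is strictly monotone. -/
theorem mem_topologicalVertices_of_injOn_of_le {W : Type*} [TopologicalSpace W] {h : W → ℝ}
    (hh : Continuous h) {V : Set W} (hV : IsOpen V) {p : W} (hp : p ∈ V) (hinj : InjOn h V)
    (hmax : ∀ x ∈ V, h x ≤ h p) : p ∈ topologicalVertices W := by
  rintro ⟨U, hU, hpU, ⟨e⟩⟩
  set ψ : ℝ → W := fun r => (e.symm r : W) with hψ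
  have hψc : Continuous ψ := continuous_subtype_val.comp e.symm.continuous
  have hψi : Function.Injective ψ := Subtype.val_injective.comp e.symm.injective
  set r₀ := e ⟨p, hpU⟩ with hr
  have hr₀ : ψ r₀ = p := by simp [hψ, hr]
  have hnhds : ψ ⁻¹' V ∈ 𝓝 r₀ := (hV.preimage hψc).mem_nhds (by simpa [hr₀] using hp)
  obtain ⟨ε, hε, hball⟩ := Metric.nhds_basis_closedBall.mem_iff.1 hnhds
  rw [Real.closedBall_eq_Icc] at hball
  have hlt : r₀ - ε ≤ r₀ + ε := by linarith
  have hmono := ContinuousOn.strictMonoOn_of_injOn_Icc' hlt (hh.comp hψc).continuousOn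
    (fun x hx y hy hxy => hψi (hinj (hball hx) (hball hy) hxy))
  have hm : ∀ r ∈ Icc (r₀ - ε) (r₀ + ε), h (ψ r) ≤ h (ψ r₀) := fun r hr => by
    rw [hr₀]; exact hmax _ (hball hr)
  have h0 : r₀ ∈ Icc (r₀ - ε) (r₀ + ε) := ⟨by linarith, by linarith⟩
  rcases hmono with H | H
  · exact (hm _ (right_mem_Icc.2 hlt)).not_gt (H h0 (right_mem_Icc.2 hlt) (by linarith))
  · exact (hm _ (left_mem_Icc.2 hlt)).not_gt (H (left_mem_Icc.2 hlt) h0 (by linarith))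

/-- The set of topological vertices is closed. -/
theorem isClosed_topologicalVertices (W : Type*) [TopologicalSpace W] :
    IsClosed (topologicalVertices W) := by
  refine ⟨isOpen_iff_forall_mem_open.2 fun w hw => ?_⟩
  obtain ⟨U, hU, hwU, hUR⟩ := not_not.1 hw
  exact ⟨U, fun x hx => not_not.2 ⟨U, hU, hx, hUR⟩, hU, hwU⟩

/-- A set is not discrete if it contains a convergent sequence of points different from the limit,
together with the limit. -/
theorem not_discreteTopology_of_tendsto {W : Type*} [TopologicalSpace W] {S : Set W} {p : ℕ → W}
    {q : W} (hp : ∀ n, p n ∈ S) (hq : q ∈ S) (hne : ∀ n, p n ≠ q)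
    (h : Filter.Tendsto p Filter.atTop (𝓝 q)) : ¬ DiscreteTopology S := by
  intro hd
  have ht : Filter.Tendsto (fun n => (⟨p n, hp n⟩ : S)) Filter.atTop (𝓝 ⟨q, hq⟩) :=
    tendsto_subtype_rng.2 h
  rw [nhds_discrete, Filter.tendsto_pure] at ht
  obtain ⟨n, hn⟩ := ht.exists
  exact hne n (congrArg Subtype.val hn)

/-- An open cell of a CW complex is homeomorphic to the open unit ball by the characteristic
map. -/
noncomputable def Topology.RelCWComplex.openCellHomeomorph {W : Type*} [TopologicalSpace W]
    {C D : Set W} [RelCWComplex C D] (n : ℕ) (e : RelCWComplex.cell C n) :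
    Metric.ball (0 : Fin n → ℝ) 1 ≃ₜ RelCWComplex.openCell n e where
  toFun x := ⟨RelCWComplex.map n e x, mem_image_of_mem _ x.2⟩
  invFun w := ⟨(RelCWComplex.map n e).symm w, by
    obtain ⟨x, hx, hxw⟩ := w.2
    rw [← RelCWComplex.source_eq n e] at hx ⊢
    rwa [← hxw, (RelCWComplex.map n e).left_inv hx]⟩
  left_inv x := by
    refine Subtype.ext ((RelCWComplex.map n e).left_inv ?_)
    rw [RelCWComplex.source_eq]
    exact x.2
  right_inv := by
    rintro ⟨_, x, hx, rfl⟩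
    rw [← RelCWComplex.source_eq n e] at hx
    exact Subtype.ext (by simp [(RelCWComplex.map n e).left_inv hx])
  continuous_toFun := by
    refine Continuous.subtype_mk ?_ _
    exact ((RelCWComplex.continuousOn n e).mono Metric.ball_subset_closedBall).domRestrict
  continuous_invFun := by
    refine Continuous.subtype_mk ?_ _
    refine ((RelCWComplex.continuousOn_symm n e).mono ?_).domRestrict
    rintro _ ⟨x, hx, rfl⟩
    rw [← RelCWComplex.source_eq n e] at hx
    exact (RelCWComplex.map n e).map_source hx

/-- A finite graph has only finitely many topological vertices: every point of an open 1-cell has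
this cell as an open neighbourhood homeomorphic to an interval. -/
theorem HasFiniteGraphStructure.finite_topologicalVertices {W : Type*} [TopologicalSpace W]
    (h : HasFiniteGraphStructure W) : (topologicalVertices W).Finite := by
  obtain ⟨hT2, G, hfin, hdim⟩ := h
  have hfin' : ∀ n, Finite (RelCWComplex.cell (univ : Set W) n) := hfin
  have hdim' : ∀ n, 1 < n → IsEmpty (RelCWComplex.cell (univ : Set W) n) := hdim
  have hcov := CWComplex.iUnion_openCell_eq_complex (C := (univ : Set W))
  have hopen : ∀ e : RelCWComplex.cell (univ : Set W) 1,
      IsOpen (RelCWComplex.openCell (C := (univ : Set W)) 1 e) := by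
    intro e
    rw [← isClosed_compl_iff]
    refine CWComplex.isClosed_of_disjoint_openCell_or_isClosed_inter_closedCell
      (C := (univ : Set W)) (subset_univ _) fun n hn j => ?_
    obtain rfl : n = 1 := by
      by_contra hn1
      exact (hdim' n (by omega)).elim j
    by_cases hje : j = e
    · subst hje
      exact Or.inl disjoint_compl_left
    · right
      have hdisj : RelCWComplex.closedCell (C := (univ : Set W)) 1 j ⊆
          (RelCWComplex.openCell (C := (univ : Set W)) 1 e)ᶜ := by
        rw [← RelCWComplex.cellFrontier_union_openCell_eq_closedCell]
        refine union_subset ?_ ?_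
        · obtain ⟨I, hI⟩ := CWComplex.cellFrontier_subset_finite_openCell
            (C := (univ : Set W)) 1 j
          refine hI.trans (iUnion₂_subset fun m hm => iUnion₂_subset fun i _ => ?_)
          refine (RelCWComplex.disjoint_openCell_of_ne ?_).subset_compl_right
          intro heq
          exact hm.ne (congrArg Sigma.fst heq)
        · refine (RelCWComplex.disjoint_openCell_of_ne ?_).subset_compl_right
          simpa using hje
      rw [inter_eq_right.2 hdisj]
      exact RelCWComplex.isClosed_closedCell
  refine (finite_iUnion fun e : RelCWComplex.cell (univ : Set W) 0 =>
    (finite_singleton (RelCWComplex.map (C := (univ : Set W)) 0 e ![]))).subset fun w hw => ?_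
  have hw' : w ∈ (univ : Set W) := mem_univ w
  rw [← hcov] at hw'
  simp only [mem_iUnion] at hw'
  obtain ⟨n, e, he⟩ := hw'
  match n with
  | 0 =>
    rw [RelCWComplex.openCell_zero_eq_singleton] at he
    exact mem_iUnion.2 ⟨e, he⟩
  | 1 =>
    refine absurd ⟨_, hopen e, he, ⟨?_⟩⟩ hw
    exact (RelCWComplex.openCellHomeomorph 1 e).symm.trans
      (Homeomorph.unitBall.symm.trans (Homeomorph.funUnique (Fin 1) ℝ))
  | n + 2 => exact (hdim' (n + 2) (by omega)).elim e

/-! ### The comb -/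

/-- The comb in the plane with height function `(u, v) ↦ u + v`: a horizontal spine
`[-s 0, s 0] × 0`, an arm going down from the origin to `(0, -s 0)`, and for each `k` a tooth which
stands on the spine at `s (k + 1)` and ends at the height `s k`, the height of the foot of the
preceding tooth. -/
def comb (s : ℕ → ℝ) : Set (ℝ × ℝ) :=
  {c | (c.1 ∈ Icc (-s 0) (s 0) ∧ c.2 = 0) ∨ (c.1 = 0 ∧ c.2 ∈ Icc (-s 0) 0) ∨
    ∃ k, c.1 = s (k + 1) ∧ c.2 ∈ Icc 0 (s k - s (k + 1))}

section Comb

variable {s : ℕ → ℝ} (hs : StrictAnti s) (hs0 : Tendsto s atTop (𝓝 0))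
include hs hs0

theorem StrictAnti.pos_of_tendsto_zero (k : ℕ) : 0 < s k :=
  (hs.antitone.le_of_tendsto hs0 (k + 1)).trans_lt (hs k.lt_succ_self)

theorem comb_level_eq_of_pos {t : ℝ} (ht : 0 < t) (ht' : t ≤ s 0) :
    ∃ a > 0, {c ∈ comb s | c.1 + c.2 = t} = {(t, 0), (t - a, a)} := by
  have hpos := hs.pos_of_tendsto_zero hs0
  have hex : ∃ k, s (k + 1) < t :=
    (((tendsto_add_atTop_iff_nat 1).2 hs0).eventually_lt_const ht).exists
  classical
  obtain ⟨k, hk, hk'⟩ : ∃ k, s (k + 1) < t ∧ t ≤ s k := by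
    refine ⟨Nat.find hex, Nat.find_spec hex, ?_⟩
    rcases h : Nat.find hex with _ | m
    · exact ht'
    · exact not_lt.1 (Nat.find_min hex (m := m) (by omega))
  refine ⟨t - s (k + 1), by linarith, Set.ext fun ⟨u, v⟩ => ?_⟩
  simp only [comb, mem_ofPred_eq, mem_insert_iff, mem_singleton_iff, Prod.mk.injEq, mem_Icc]
  constructor
  · rintro ⟨⟨-, h⟩ | ⟨rfl, -, h⟩ | ⟨j, rfl, h0, h1⟩, hsum⟩
    · exact Or.inl ⟨by linarith, h⟩
    · linarith
    · rcases lt_trichotomy j k with hjk | rfl | hjk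
      · have := hs.antitone (Nat.succ_le_of_lt hjk)
        rw [Nat.succ_eq_add_one] at this
        left
        constructor <;> linarith
      · right
        constructor <;> linarith
      · have := hs.antitone (Nat.succ_le_of_lt hjk)
        rw [Nat.succ_eq_add_one] at this
        linarith
  · have := hpos 0
    rintro (⟨rfl, rfl⟩ | ⟨rfl, rfl⟩)
    · exact ⟨Or.inl ⟨⟨by linarith, ht'⟩, rfl⟩, by ring⟩
    · exact ⟨Or.inr (Or.inr ⟨k, by ring, by linarith, by linarith⟩), by ring⟩

theorem comb_level_eq_of_neg {t : ℝ} (ht : t < 0) (ht' : -s 0 ≤ t) :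
    {c ∈ comb s | c.1 + c.2 = t} = {(t, 0), (0, t)} := by
  have hpos := hs.pos_of_tendsto_zero hs0
  ext ⟨u, v⟩
  simp only [comb, mem_ofPred_eq, mem_insert_iff, mem_singleton_iff, Prod.mk.injEq, mem_Icc]
  constructor
  · rintro ⟨⟨-, h⟩ | ⟨h, -⟩ | ⟨j, rfl, h0, h1⟩, hsum⟩
    · exact Or.inl ⟨by linarith, h⟩
    · exact Or.inr ⟨h, by linarith⟩
    · linarith [hpos (j + 1)]
  · rintro (⟨rfl, rfl⟩ | ⟨rfl, rfl⟩)
    · exact ⟨Or.inl ⟨⟨ht', by linarith [hpos 0]⟩, rfl⟩, by ring⟩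
    · exact ⟨Or.inr (Or.inl ⟨rfl, ht', ht.le⟩), by ring⟩

theorem comb_level_zero : {c ∈ comb s | c.1 + c.2 = 0} = {(0, 0)} := by
  have hpos := hs.pos_of_tendsto_zero hs0
  ext ⟨u, v⟩
  simp only [comb, mem_ofPred_eq, mem_singleton_iff, Prod.mk.injEq, mem_Icc]
  constructor
  · rintro ⟨⟨-, h⟩ | ⟨h, -⟩ | ⟨j, rfl, h0, h1⟩, hsum⟩
    · exact ⟨by linarith, h⟩
    · exact ⟨h, by linarith⟩
    · linarith [hpos (j + 1)]
  · rintro ⟨rfl, rfl⟩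
    exact ⟨Or.inl ⟨⟨by linarith [hpos 0], (hpos 0).le⟩, rfl⟩, by ring⟩

theorem comb_height_image : (fun c : ℝ × ℝ => c.1 + c.2) '' comb s = Icc (-s 0) (s 0) := by
  have hpos := hs.pos_of_tendsto_zero hs0
  ext t
  constructor
  · rintro ⟨⟨u, v⟩, ⟨h, h'⟩ | ⟨h, h', h''⟩ | ⟨j, h, h', h''⟩, rfl⟩
    · simpa [show v = 0 from h'] using h
    · simp only at h h' h''
      constructor <;> dsimp only <;> linarith [hpos 0]
    · simp only at h h' h''
      have := hs.antitone (Nat.zero_le j)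
      constructor <;> dsimp only <;> linarith [hpos 0, hpos (j + 1)]
  · intro ht
    exact ⟨(t, 0), Or.inl ⟨ht, rfl⟩, add_zero t⟩

theorem finite_comb_level (t : ℝ) : {c ∈ comb s | c.1 + c.2 = t}.Finite := by
  by_cases h : t ∈ Icc (-s 0) (s 0)
  · rcases lt_trichotomy t 0 with h' | rfl | h'
    · rw [comb_level_eq_of_neg hs hs0 h' h.1]
      exact toFinite _
    · rw [comb_level_zero hs hs0]
      exact toFinite _
    · obtain ⟨a, -, h⟩ := comb_level_eq_of_pos hs hs0 h' h.2
      rw [h]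
      exact toFinite _
  · refine finite_empty.subset fun c hc => h ?_
    rw [← comb_height_image hs hs0]
    exact ⟨c, hc⟩

theorem ncard_comb_level {t : ℝ} (ht : t ∈ Icc (-s 0) (s 0)) (ht0 : t ≠ 0) :
    {c ∈ comb s | c.1 + c.2 = t}.ncard = 2 := by
  rcases lt_or_gt_of_ne ht0 with h' | h'
  · rw [comb_level_eq_of_neg hs hs0 h' ht.1]
    exact ncard_pair (by simp [ht0])
  · obtain ⟨a, ha, h⟩ := comb_level_eq_of_pos hs hs0 h' ht.2
    rw [h]
    exact ncard_pair (by simp [ha.ne])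

/-- The height is injective on the union of the teeth without their base points. -/
theorem comb_eq_of_snd_pos {c c' : ℝ × ℝ} (hc : c ∈ comb s) (hc' : c' ∈ comb s)
    (h : c.1 + c.2 = c'.1 + c'.2) (hpos : 0 < c.2) (hpos' : 0 < c'.2) : c = c' := by
  have hmem : c.1 + c.2 ∈ Icc (-s 0) (s 0) := by
    rw [← comb_height_image hs hs0]
    exact ⟨c, hc, rfl⟩
  have ht : 0 < c.1 + c.2 := by
    rcases hc with ⟨-, h⟩ | ⟨-, -, h⟩ | ⟨k, h, -⟩
    · linarith
    · linarith
    · linarith [hs.pos_of_tendsto_zero hs0 (k + 1)]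
  obtain ⟨a, -, hset⟩ := comb_level_eq_of_pos hs hs0 ht hmem.2
  have key : ∀ d ∈ comb s, d.1 + d.2 = c.1 + c.2 → 0 < d.2 → d = (c.1 + c.2 - a, a) := by
    intro d hd hd' hdpos
    have : d ∈ ({(c.1 + c.2, 0), (c.1 + c.2 - a, a)} : Set (ℝ × ℝ)) := hset ▸ ⟨hd, hd'⟩
    rcases this with rfl | h
    · exact absurd hdpos (lt_irrefl _)
    · exact h
  rw [key c hc rfl hpos, key c' hc' h.symm hpos']

end Comb

/-! ### Functions with a comb as Reeb space -/

section CombReeb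

variable {X : Type*} [TopologicalSpace X] {s : ℕ → ℝ} {g : X → ℝ × ℝ} {F : X → ℝ}

/-- `F` is the height of a continuous map `g` onto the comb with connected fibres. The fibres of `g`
are then the components of the level sets of `F`, so that `g` identifies the Reeb space of `F` with
the comb. -/
structure FactorsThroughComb (F : X → ℝ) (g : X → ℝ × ℝ) (s : ℕ → ℝ) : Prop where
  strictAnti : StrictAnti s
  tendsto : Tendsto s atTop (𝓝 0)
  continuous : Continuous g
  height : ∀ x, F x = (g x).1 + (g x).2
  isPreconnected_fibre : ∀ c, IsPreconnected (g ⁻¹' {c})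
  range_eq : range g = comb s

namespace FactorsThroughComb

variable (h : FactorsThroughComb F g s)
include h

theorem image_level (t : ℝ) : g '' (F ⁻¹' {t}) = {c ∈ comb s | c.1 + c.2 = t} := by
  ext c
  rw [← h.range_eq]
  constructor
  · rintro ⟨x, hx, rfl⟩
    exact ⟨mem_range_self x, (h.height x).symm.trans hx⟩
  · rintro ⟨⟨x, rfl⟩, hx⟩
    exact ⟨x, (h.height x).trans hx, rfl⟩

theorem finite_image_level (t : ℝ) : (g '' (F ⁻¹' {t})).Finite := by
  rw [h.image_level]
  exact finite_comb_level h.strictAnti h.tendsto t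

theorem range_height : range F = Icc (-s 0) (s 0) := by
  rw [← comb_height_image h.strictAnti h.tendsto, ← h.range_eq, ← range_comp]
  exact congrArg range (funext h.height)

theorem card_components {t : ℝ} (ht : t ∈ Icc (-s 0) (s 0)) (ht0 : t ≠ 0) :
    Nat.card (ConnectedComponents (F ⁻¹' {t})) = 2 := by
  rw [card_connectedComponents_level h.continuous (π := fun c => c.1 + c.2) h.height
    h.isPreconnected_fibre h.finite_image_level, h.image_level,
    ncard_comb_level h.strictAnti h.tendsto ht ht0]

theorem isConnected_zero_level : IsConnected (F ⁻¹' {0}) := by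
  have himg : g '' (F ⁻¹' {0}) = {(0, 0)} := by
    rw [h.image_level, comb_level_zero h.strictAnti h.tendsto]
  have heq : F ⁻¹' {0} = g ⁻¹' {(0, 0)} := by
    refine Subset.antisymm (image_subset_iff.1 himg.subset) fun x hx => ?_
    rw [mem_preimage, mem_singleton_iff] at hx ⊢
    rw [h.height, hx, add_zero]
  refine ⟨image_nonempty.1 (himg ▸ singleton_nonempty _), ?_⟩
  rw [heq]
  exact h.isPreconnected_fibre _

theorem quotientMap_eq_iff (x y : X) :
    reebQuotientMap F x = reebQuotientMap F y ↔ g x = g y :=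
  reebQuotientMap_eq_iff h.continuous (π := fun c => c.1 + c.2) h.height
    h.isPreconnected_fibre h.finite_image_level x y

/-- The identification of the Reeb space with the comb. -/
theorem exists_isEmbedding [CompactSpace X] : ∃ j : ReebSpace F → ℝ × ℝ, IsEmbedding j ∧
    range j = comb s ∧ ∀ x, j (reebQuotientMap F x) = g x := by
  refine ⟨Quotient.lift g fun x y hxy => (h.quotientMap_eq_iff x y).1 (Quotient.sound hxy),
    (Continuous.isClosedEmbedding (h.continuous.quotient_lift _) ?_).isEmbedding,
    (range_quot_lift _).trans h.range_eq, fun x => rfl⟩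
  rintro ⟨x⟩ ⟨y⟩ hxy
  exact (h.quotientMap_eq_iff x y).2 hxy

theorem isDendrite [CompactSpace X] [ConnectedSpace X] [LocallyConnectedSpace X] :
    IsDendrite (ReebSpace F) := by
  obtain ⟨j, hj, hrange, -⟩ := h.exists_isEmbedding
  refine ⟨inferInstance, inferInstance, ?_, hj.metrizableSpace, ?_⟩
  · exact (isQuotientMap_quotient_mk' (s := reebSetoid F)).isCoinducing.locallyConnectedSpace
  · -- Over all values of the first coordinate but countably many, the comb is only the spine.
    refine not_exists_circle_embedding (u := fun w => (j w).1) (v := fun w => (j w).2)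
      (continuous_fst.comp hj.continuous) (continuous_snd.comp hj.continuous)
      (fun x y hx hy => hj.injective (Prod.ext hx hy))
      (S := insert 0 (range s)) ((countable_range s).insert 0) ?_
    have hzero : ∀ x, (j x).1 ∉ insert 0 (range s) → (j x).2 = 0 := by
      intro x hx
      have hxm : j x ∈ comb s := hrange ▸ mem_range_self x
      rcases hxm with ⟨-, h⟩ | ⟨h, -⟩ | ⟨k, h, -⟩
      · exact h
      · exact absurd (Or.inl h) hx
      · exact absurd (Or.inr ⟨_, h.symm⟩) hx
    intro x y hxy hx
    refine hj.injective (Prod.ext hxy ?_)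
    rw [hzero x hx, hzero y (by rwa [← hxy])]

/-- The tips of the teeth are topological vertices of the Reeb space. -/
theorem tip_mem_topologicalVertices [CompactSpace X] {k : ℕ} {x : X}
    (hx : g x = (s (k + 1), s k - s (k + 1))) :
    reebQuotientMap F x ∈ topologicalVertices (ReebSpace F) := by
  obtain ⟨j, hj, hrange, hjg⟩ := h.exists_isEmbedding
  have hjm : ∀ w, j w ∈ comb s := fun w => hrange ▸ mem_range_self w
  have hj1 : Continuous fun w => (j w).1 := continuous_fst.comp hj.continuous
  have hj2 : Continuous fun w => (j w).2 := continuous_snd.comp hj.continuous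
  -- Near the tip there are only points of this tooth and of teeth which stay below its tip.
  refine mem_topologicalVertices_of_injOn_of_le (h := fun w => (j w).1 + (j w).2) (hj1.add hj2)
    (V := {w | 0 < (j w).2} ∩ {w | (j w).1 < s k})
    ((isOpen_lt continuous_const hj2).inter (isOpen_lt hj1 continuous_const)) ?_ ?_ ?_
  · simp only [mem_inter_iff, mem_ofPred_eq, hjg, hx]
    exact ⟨sub_pos.2 (h.strictAnti k.lt_succ_self), h.strictAnti k.lt_succ_self⟩
  · intro w hw w' hw' hww
    exact hj.injective (comb_eq_of_snd_pos h.strictAnti h.tendsto (hjm w) (hjm w') hww hw.1 hw'.1)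
  · rintro w ⟨hw1, hw2⟩
    simp only [mem_ofPred_eq] at hw1 hw2
    simp only [hjg, hx]
    rcases hjm w with ⟨-, h0⟩ | ⟨-, -, h0⟩ | ⟨m, h1, -, h2⟩
    · linarith
    · linarith
    · rw [h1] at hw2
      have := h.strictAnti.antitone (show k ≤ m from by
        have := h.strictAnti.lt_iff_gt.1 hw2
        omega)
      linarith

theorem not_hasFiniteGraphStructure [CompactSpace X] : ¬ HasFiniteGraphStructure (ReebSpace F) := by
  intro hG
  have htip : ∀ k, ∃ x, g x = (s (k + 1), s k - s (k + 1)) := fun k => by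
    rw [← mem_range, h.range_eq]
    exact Or.inr (Or.inr ⟨k, rfl, (sub_pos.2 (h.strictAnti k.lt_succ_self)).le, le_rfl⟩)
  choose x hx using htip
  refine infinite_of_injective_forall_mem (f := fun k => reebQuotientMap F (x k)) ?_
    (fun k => h.tip_mem_topologicalVertices (hx k)) hG.finite_topologicalVertices
  intro k m hkm
  have := (h.quotientMap_eq_iff _ _).1 hkm
  rw [hx, hx, Prod.mk.injEq] at this
  exact Nat.succ_injective (h.strictAnti.injective this.1)

/-- A set of points of the Reeb space is not discrete if it contains the tips of all teeth and
their limit. -/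
theorem not_discreteTopology_of_tips {x : ℕ → X} {a : X} (hxa : Tendsto x atTop (𝓝 a))
    (hx : ∀ k, g (x k) = (s (k + 1), s k - s (k + 1))) {S : Set (ReebSpace F)}
    (hS : ∀ k, reebQuotientMap F (x k) ∈ S) (ha : reebQuotientMap F a ∈ S) :
    ¬ DiscreteTopology S := by
  refine not_discreteTopology_of_tendsto hS ha ?_
    ((continuous_quotient_mk'.tendsto a).comp hxa)
  have hlim : Tendsto (fun k => (g (x k)).1) atTop (𝓝 0) := by
    simp only [hx]
    exact (tendsto_add_atTop_iff_nat 1).2 h.tendsto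
  have ha1 : (g a).1 = 0 := tendsto_nhds_unique
    (((continuous_fst.comp h.continuous).tendsto a).comp hxa) hlim
  intro k hk
  have := congrArg Prod.fst ((h.quotientMap_eq_iff _ _).1 hk)
  rw [hx, ha1] at this
  exact (h.strictAnti.pos_of_tendsto_zero h.tendsto (k + 1)).ne' this

end FactorsThroughComb

end CombReeb

/-! ### Connected subsets of the sphere -/

/-- The point of the sphere with the given coordinates. -/
noncomputable def Sphere2.mk (x y z : ℝ) (h : x ^ 2 + y ^ 2 + z ^ 2 = 1) : Sphere2 :=
  ⟨!₂[x, y, z], by simp [EuclideanSpace.norm_eq, Fin.sum_univ_three, h]⟩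

namespace Sphere2

@[simp]
theorem coe_mk_zero (x y z : ℝ) (h : x ^ 2 + y ^ 2 + z ^ 2 = 1) : (mk x y z h).1 0 = x := rfl

@[simp]
theorem coe_mk_one (x y z : ℝ) (h : x ^ 2 + y ^ 2 + z ^ 2 = 1) : (mk x y z h).1 1 = y := rfl

@[simp]
theorem coe_mk_two (x y z : ℝ) (h : x ^ 2 + y ^ 2 + z ^ 2 = 1) : (mk x y z h).1 2 = z := rfl

theorem sum_sq (p : Sphere2) : p.1 0 ^ 2 + p.1 1 ^ 2 + p.1 2 ^ 2 = 1 := by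
  have := EuclideanSpace.norm_sq_eq p.1
  rw [norm_eq_of_mem_sphere p, Fin.sum_univ_three] at this
  simpa using this.symm

theorem ext_coord {p q : Sphere2} (h0 : p.1 0 = q.1 0) (h1 : p.1 1 = q.1 1)
    (h2 : p.1 2 = q.1 2) : p = q := by
  refine Subtype.ext (PiLp.ext fun i => ?_)
  fin_cases i <;> assumption

theorem continuous_mk {T : Type*} [TopologicalSpace T] {x y z : T → ℝ} (hx : Continuous x)
    (hy : Continuous y) (hz : Continuous z) (h : ∀ t, x t ^ 2 + y t ^ 2 + z t ^ 2 = 1) :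
    Continuous fun t => mk (x t) (y t) (z t) (h t) := by
  refine Continuous.subtype_mk ((PiLp.continuous_toLp 2 _).comp (continuous_pi fun i => ?_)) _
  fin_cases i <;> assumption

theorem continuous_coord (i : Fin 3) : Continuous fun p : Sphere2 => p.1 i :=
  (PiLp.continuous_apply 2 _ i).comp continuous_subtype_val

/-- A subset of a zone of the sphere is connected if it contains the meridian in the half-plane
`y = 0`, `x ≤ 0` and if, on every circle of latitude, it is closed under decreasing `x`: each of its
points can be moved to the meridian along its circle of latitude. -/
theorem isPreconnected_zone_inter {J : Set ℝ} (hJ : J.OrdConnected) {A : Set Sphere2}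
    (hA : ∀ p ∈ A, ∀ q : Sphere2, q.1 2 = p.1 2 → q.1 0 ≤ p.1 0 → q ∈ A)
    (hm : ∀ p : Sphere2, p.1 0 ≤ 0 → p.1 1 = 0 → p ∈ A) :
    IsPreconnected {p : Sphere2 | p.1 2 ∈ J ∧ p ∈ A} := by
  have hmer : ∀ z ∈ Icc (-1 : ℝ) 1, (-√(1 - z ^ 2)) ^ 2 + 0 ^ 2 + z ^ 2 = 1 := by
    intro z hz
    rw [neg_sq, Real.sq_sqrt (by nlinarith [hz.1, hz.2])]
    ring
  let mer : ↥(J ∩ Icc (-1 : ℝ) 1) → Sphere2 := fun z => mk (-√(1 - z.1 ^ 2)) 0 z.1 (hmer z z.2.2)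
  have hmerc : Continuous mer := continuous_mk (by fun_prop) (by fun_prop) (by fun_prop) _
  have hmerp : IsPreconnected (range mer) := by
    have : PreconnectedSpace ↥(J ∩ Icc (-1 : ℝ) 1) :=
      isPreconnected_iff_preconnectedSpace.1 (hJ.inter ordConnected_Icc).isPreconnected
    exact isPreconnected_range hmerc
  have hmers : range mer ⊆ {p : Sphere2 | p.1 2 ∈ J ∧ p ∈ A} := by
    rintro _ ⟨z, rfl⟩
    exact ⟨z.2.1, hm _ (neg_nonpos.2 (Real.sqrt_nonneg _)) rfl⟩
  have hz : ∀ p : Sphere2, p.1 2 ∈ Icc (-1 : ℝ) 1 := fun p => by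
    have := p.sum_sq
    constructor <;> nlinarith [sq_nonneg (p.1 0), sq_nonneg (p.1 1)]
  rcases eq_empty_or_nonempty {p : Sphere2 | p.1 2 ∈ J ∧ p ∈ A} with he | ⟨p₀, hp₀⟩
  · rw [he]
    exact isPreconnected_empty
  refine isPreconnected_of_forall (mer ⟨p₀.1 2, hp₀.1, hz p₀⟩) fun p hp => ?_
  obtain ⟨ε, hε, hεp⟩ : ∃ ε : ℝ, ε ^ 2 = 1 ∧ ε * |p.1 1| = p.1 1 := by
    rcases le_total 0 (p.1 1) with h | h
    · exact ⟨1, by norm_num, by rw [abs_of_nonneg h, one_mul]⟩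
    · exact ⟨-1, by norm_num, by rw [abs_of_nonpos h]; ring⟩
  set r := √(1 - p.1 2 ^ 2) with hr
  have hr2 : r ^ 2 = 1 - p.1 2 ^ 2 := Real.sq_sqrt (by nlinarith [(hz p).1, (hz p).2])
  have hpr : |p.1 0| ≤ r := abs_le_of_sq_le_sq (by nlinarith [p.sum_sq, sq_nonneg (p.1 1)])
    (Real.sqrt_nonneg _)
  have harcs : ∀ x ∈ Icc (-r) (p.1 0), x ^ 2 + (ε * √(r ^ 2 - x ^ 2)) ^ 2 + p.1 2 ^ 2 = 1 := by
    intro x hx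
    have : x ^ 2 ≤ r ^ 2 := sq_le_sq' hx.1 (hx.2.trans ((le_abs_self _).trans hpr))
    rw [mul_pow, hε, Real.sq_sqrt (by linarith), hr2]
    ring
  let arc : ↥(Icc (-r) (p.1 0)) → Sphere2 :=
    fun x => mk x.1 (ε * √(r ^ 2 - x.1 ^ 2)) (p.1 2) (harcs x x.2)
  have harcc : Continuous arc := continuous_mk (by fun_prop) (by fun_prop) (by fun_prop) _
  have harcp : IsPreconnected (range arc) := by
    have : PreconnectedSpace ↥(Icc (-r) (p.1 0)) :=
      isPreconnected_iff_preconnectedSpace.1 isPreconnected_Icc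
    exact isPreconnected_range harcc
  have harcA : range arc ⊆ {p : Sphere2 | p.1 2 ∈ J ∧ p ∈ A} := by
    rintro _ ⟨x, rfl⟩
    exact ⟨hp.1, hA p hp.2 _ rfl x.2.2⟩
  have hle : -r ≤ p.1 0 := (abs_le.1 hpr).1
  have hstart : arc ⟨-r, left_mem_Icc.2 hle⟩ = mer ⟨p.1 2, hp.1, hz p⟩ := by
    refine ext_coord rfl ?_ rfl
    simp [arc, mer]
  refine ⟨range mer ∪ range arc, union_subset hmers harcA, Or.inl (mem_range_self _),
    Or.inr ⟨⟨p.1 0, right_mem_Icc.2 hle⟩, ?_⟩,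
    hmerp.union (mer ⟨p.1 2, hp.1, hz p⟩) (mem_range_self _) (hstart ▸ mem_range_self _) harcp⟩
  refine ext_coord rfl ?_ rfl
  have : r ^ 2 - p.1 0 ^ 2 = p.1 1 ^ 2 := by linarith [p.sum_sq]
  simp [arc, this, Real.sqrt_sq_eq_abs, hεp]

/-- A zone of the sphere about the axis through `(a, 0, b)` is connected. -/
theorem isPreconnected_zone {J : Set ℝ} (hJ : J.OrdConnected) {a b : ℝ} (hab : a ^ 2 + b ^ 2 = 1) :
    IsPreconnected {p : Sphere2 | a * p.1 0 + b * p.1 2 ∈ J} := by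
  -- The rotation which takes the third basis vector to `(a, 0, b)`.
  let ρ : Sphere2 → Sphere2 := fun p => mk (b * p.1 0 + a * p.1 2) (p.1 1) (b * p.1 2 - a * p.1 0)
    (by linear_combination p.sum_sq + (p.1 0 ^ 2 + p.1 2 ^ 2) * hab)
  have hρ : Continuous ρ := by
    have h0 := continuous_coord 0
    have h1 := continuous_coord 1
    have h2 := continuous_coord 2
    exact continuous_mk (by fun_prop) h1 (by fun_prop) _
  have himg : {p : Sphere2 | a * p.1 0 + b * p.1 2 ∈ J} =
      ρ '' {p : Sphere2 | p.1 2 ∈ J ∧ p ∈ (univ : Set Sphere2)} := by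
    refine Subset.antisymm (fun p hp => ?_) ?_
    · refine ⟨mk (b * p.1 0 - a * p.1 2) (p.1 1) (a * p.1 0 + b * p.1 2)
        (by linear_combination p.sum_sq + (p.1 0 ^ 2 + p.1 2 ^ 2) * hab), ⟨hp, mem_univ _⟩,
        ext_coord ?_ rfl ?_⟩
      · simp only [ρ, coe_mk_zero, coe_mk_two]
        linear_combination p.1 0 * hab
      · simp only [ρ, coe_mk_zero, coe_mk_two]
        linear_combination p.1 2 * hab
    · rintro _ ⟨p, ⟨hp, -⟩, rfl⟩
      have : a * (ρ p).1 0 + b * (ρ p).1 2 = p.1 2 := by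
        simp only [ρ, coe_mk_zero, coe_mk_two]
        linear_combination p.1 2 * hab
      rwa [mem_ofPred_eq, this]
  rw [himg]
  exact (isPreconnected_zone_inter hJ (fun _ _ _ _ _ => mem_univ _) fun _ _ _ => mem_univ _).image
    _ hρ.continuousOn

instance : ConnectedSpace Sphere2 :=
  isConnected_iff_connectedSpace.1 (isConnected_sphere
    (by rw [← Module.finrank_eq_rank, finrank_euclideanSpace_fin]; norm_num) _ zero_le_one)

instance : LocallyConnectedSpace Sphere2 :=
  ChartedSpace.locallyConnectedSpace (EuclideanSpace ℝ (Fin 2)) Sphere2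

end Sphere2

/-! ### Caps -/

/-- The point of the sphere with `y = 0`, `0 ≤ x` and third coordinate `ζ`, for `|ζ| ≤ 1`. -/
noncomputable def capCenter (ζ : ℝ) : EuclideanSpace ℝ (Fin 3) :=
  !₂[√(1 - ζ ^ 2), 0, ζ]

/-- A smooth bump function with maximum `1` at the point `capCenter ζ`, supported in the ball of
radius `|ζ| / 3` about it. -/
noncomputable def capBump (ζ : ℝ) (p : EuclideanSpace ℝ (Fin 3)) : ℝ :=
  Real.smoothTransition (1 - 9 * ‖p - capCenter ζ‖ ^ 2 / ζ ^ 2)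

theorem contDiff_capBump (ζ : ℝ) : ContDiff ℝ ∞ (capBump ζ) :=
  Real.smoothTransition.contDiff.comp (contDiff_const.sub
    ((contDiff_const.mul ((contDiff_id.sub contDiff_const).norm_sq ℝ)).div_const _))

theorem capBump_nonneg (ζ : ℝ) (p : EuclideanSpace ℝ (Fin 3)) : 0 ≤ capBump ζ p :=
  Real.smoothTransition.nonneg _

theorem capBump_le_one (ζ : ℝ) (p : EuclideanSpace ℝ (Fin 3)) : capBump ζ p ≤ 1 :=
  Real.smoothTransition.le_one _

theorem capBump_capCenter (ζ : ℝ) : capBump ζ (capCenter ζ) = 1 := by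
  simp [capBump]

theorem sq_norm_sub_capCenter_lt {ζ : ℝ} (hζ : ζ ≠ 0) {p : EuclideanSpace ℝ (Fin 3)}
    (hp : capBump ζ p ≠ 0) : ‖p - capCenter ζ‖ ^ 2 < ζ ^ 2 / 9 := by
  have h : 0 < 1 - 9 * ‖p - capCenter ζ‖ ^ 2 / ζ ^ 2 := by
    by_contra! h
    exact hp (Real.smoothTransition.zero_of_nonpos h)
  have h2 : 0 < ζ ^ 2 := by positivity
  rw [sub_pos, div_lt_one h2] at h
  linarith

/-- The cap about `capCenter ζ` lies strictly between the heights `2 / 3 * ζ` and `4 / 3 * ζ`. -/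
theorem abs_sub_lt_of_capBump_ne_zero {ζ : ℝ} (hζ : ζ ≠ 0) {p : EuclideanSpace ℝ (Fin 3)}
    (hp : capBump ζ p ≠ 0) : |p 2 - ζ| < |ζ| / 3 := by
  have h := sq_norm_sub_capCenter_lt hζ hp
  have h2 : (p 2 - ζ) ^ 2 ≤ ‖p - capCenter ζ‖ ^ 2 := by
    rw [EuclideanSpace.norm_sq_eq, Fin.sum_univ_three]
    have : (p - capCenter ζ) 2 = p 2 - ζ := rfl
    rw [this, Real.norm_eq_abs (p 2 - ζ), sq_abs]
    nlinarith [sq_nonneg ‖(p - capCenter ζ) 0‖, sq_nonneg ‖(p - capCenter ζ) 1‖]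
  refine abs_lt_of_sq_lt_sq ?_ (by positivity)
  rw [div_pow, sq_abs]
  linarith

/-- A cap is contained in the half-space `0 < x`. -/
theorem capBump_eq_zero_of_nonpos {ζ : ℝ} (hζ : ζ ≠ 0) (hζ' : |ζ| ≤ 1 / 2)
    {p : EuclideanSpace ℝ (Fin 3)} (hp : p 0 ≤ 0) : capBump ζ p = 0 := by
  by_contra hne
  have h := sq_norm_sub_capCenter_lt hζ hne
  have hζ2 : ζ ^ 2 ≤ (1 / 2) ^ 2 := by
    rw [← sq_abs]
    gcongr
  have h2 : (p 0 - √(1 - ζ ^ 2)) ^ 2 ≤ ‖p - capCenter ζ‖ ^ 2 := by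
    rw [EuclideanSpace.norm_sq_eq, Fin.sum_univ_three]
    have : (p - capCenter ζ) 0 = p 0 - √(1 - ζ ^ 2) := rfl
    rw [this, Real.norm_eq_abs (p 0 - _), sq_abs]
    nlinarith [sq_nonneg ‖(p - capCenter ζ) 2‖, sq_nonneg ‖(p - capCenter ζ) 1‖]
  have h3 : √(1 - ζ ^ 2) ^ 2 = 1 - ζ ^ 2 := Real.sq_sqrt (by linarith)
  nlinarith [mul_nonneg (neg_nonneg.2 hp) (Real.sqrt_nonneg (1 - ζ ^ 2))]

/-- On the sphere, a cap bump is a monotone function of the scalar product with its centre. -/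
theorem capBump_sphere {ζ : ℝ} (hζ' : |ζ| ≤ 1 / 2) (p : Sphere2) :
    capBump ζ p.1 = Real.smoothTransition
      (1 - 9 * (2 - 2 * (√(1 - ζ ^ 2) * p.1 0 + ζ * p.1 2)) / ζ ^ 2) := by
  have hζ2 : ζ ^ 2 ≤ (1 / 2) ^ 2 := by
    rw [← sq_abs]
    gcongr
  have h3 : √(1 - ζ ^ 2) ^ 2 = 1 - ζ ^ 2 := Real.sq_sqrt (by linarith)
  rw [capBump]
  congr 4
  rw [EuclideanSpace.norm_sq_eq, Fin.sum_univ_three]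
  have h0 : (p.1 - capCenter ζ) 0 = p.1 0 - √(1 - ζ ^ 2) := rfl
  have h1 : (p.1 - capCenter ζ) 1 = p.1 1 - 0 := rfl
  have h2 : (p.1 - capCenter ζ) 2 = p.1 2 - ζ := rfl
  simp only [h0, h1, h2, Real.norm_eq_abs, sq_abs]
  linear_combination p.sum_sq + h3

theorem monotone_transition_inner (ζ : ℝ) :
    Monotone fun l : ℝ => Real.smoothTransition (1 - 9 * (2 - 2 * l) / ζ ^ 2) := by
  intro l m hlm
  apply Real.smoothTransition.monotone
  gcongr

theorem capBump_le_capBump {ζ : ℝ} (hζ' : |ζ| ≤ 1 / 2) {p q : Sphere2} (h2 : q.1 2 = p.1 2)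
    (h0 : q.1 0 ≤ p.1 0) : capBump ζ q.1 ≤ capBump ζ p.1 := by
  rw [capBump_sphere hζ', capBump_sphere hζ', h2]
  apply monotone_transition_inner
  gcongr

theorem isPreconnected_capBump_level {ζ : ℝ} (hζ' : |ζ| ≤ 1 / 2) (w : ℝ) :
    IsPreconnected {p : Sphere2 | capBump ζ p.1 = w} := by
  have hζ2 : ζ ^ 2 ≤ (1 / 2) ^ 2 := by
    rw [← sq_abs]
    gcongr
  have h3 : √(1 - ζ ^ 2) ^ 2 + ζ ^ 2 = 1 := by
    rw [Real.sq_sqrt (by linarith)]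
    ring
  simp only [capBump_sphere hζ']
  exact Sphere2.isPreconnected_zone
    (ordConnected_singleton.preimage_mono (monotone_transition_inner ζ)) h3

theorem capCenter_mem_sphere {ζ : ℝ} (hζ' : |ζ| ≤ 1 / 2) :
    capCenter ζ ∈ Metric.sphere (0 : EuclideanSpace ℝ (Fin 3)) 1 := by
  have hζ2 : ζ ^ 2 ≤ (1 / 2) ^ 2 := by
    rw [← sq_abs]
    gcongr
  exact (Sphere2.mk (√(1 - ζ ^ 2)) 0 ζ (by rw [Real.sq_sqrt (by linarith)]; ring)).2

theorem exists_capBump_eq {ζ : ℝ} (hζ : ζ ≠ 0) (hζ' : |ζ| ≤ 1 / 2) {w : ℝ} (hw : w ∈ Icc 0 1) :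
    ∃ p : Sphere2, capBump ζ p.1 = w := by
  have hcont : Continuous fun p : Sphere2 => capBump ζ p.1 :=
    (contDiff_capBump ζ).continuous.comp continuous_subtype_val
  have h0 : capBump ζ (Sphere2.mk (-1) 0 0 (by norm_num)).1 = 0 :=
    capBump_eq_zero_of_nonpos hζ hζ' (by simp)
  have h1 : capBump ζ (⟨capCenter ζ, capCenter_mem_sphere hζ'⟩ : Sphere2).1 = 1 :=
    capBump_capCenter ζ
  exact mem_range_of_exists_le_of_exists_ge hcont ⟨_, h0.trans_le hw.1⟩ ⟨_, hw.2.trans_eq h1.symm⟩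

/-! ### The series for the spine and the teeth -/

/-- The third coordinates of the centres of the caps: one negative, the others positive and
converging to `0`. -/
noncomputable def capHeight : ℕ → ℝ
  | 0 => -1 / 4
  | k + 1 => 3 / 8 * (1 / 4) ^ k

/-- The ramps whose combination is the spine: the ramp with number `0` rises from `0` to `1` as `z`
goes down from `-1 / 2` to `-1`, and the ramp with number `k + 1` rises from `0` to `1` as `z` goes
up from `(1 / 4) ^ k / 2` to `(1 / 4) ^ k`. -/
noncomputable def ramp : ℕ → ℝ → ℝ
  | 0, z => Real.smoothTransition (-2 * z - 1)
  | k + 1, z => Real.smoothTransition (2 * 4 ^ k * z - 1)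

/-- The heights of the branching points of the comb, and `0`: the sums of the tails of the sequence
of lengths of the teeth. The length with number `0` belongs to the arm below the origin. -/
noncomputable def tailSum (η : ℕ → ℝ) (k : ℕ) : ℝ := ∑' j, η (j + k + 1)

/-- The value of the spine at the cap with a given number. -/
noncomputable def plateau (η : ℕ → ℝ) : ℕ → ℝ
  | 0 => 0
  | k + 1 => tailSum η (k + 1)

/-- A monotone function of the height on the sphere, constant on a neighbourhood of each cap. -/
noncomputable def spine (η : ℕ → ℝ) (z : ℝ) : ℝ := ∑' i, η i * ramp i z

/-- The combination of the cap bumps. -/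
noncomputable def teeth (η : ℕ → ℝ) (p : EuclideanSpace ℝ (Fin 3)) : ℝ :=
  ∑' i, η i * capBump (capHeight i) p

/-- Admissible signed lengths of the teeth of a comb: the negative one with number `0` balances the
sum of the others, which are positive. -/
structure IsToothLength (η : ℕ → ℝ) : Prop where
  pos : ∀ k, 0 < η (k + 1)
  summable : Summable η
  balance : η 0 = -tailSum η 0

theorem capHeight_ne_zero (i : ℕ) : capHeight i ≠ 0 := by
  cases i <;> simp [capHeight]

theorem abs_capHeight_le (i : ℕ) : |capHeight i| ≤ 1 / 2 := by
  cases i with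
  | zero => norm_num [capHeight, abs_le]
  | succ k =>
    rw [capHeight, abs_of_pos (by positivity)]
    have : ((1 : ℝ) / 4) ^ k ≤ 1 := pow_le_one₀ (by norm_num) (by norm_num)
    linarith

/-- The caps lie in pairwise disjoint zones of the sphere. -/
theorem capHeight_zone {i : ℕ} {p : EuclideanSpace ℝ (Fin 3)}
    (hp : capBump (capHeight i) p ≠ 0) :
    (i = 0 ∧ p 2 ∈ Icc (-1 / 2 : ℝ) 0) ∨
      ∃ k, i = k + 1 ∧ p 2 ∈ Icc ((1 / 4 : ℝ) ^ (k + 1)) ((1 / 4) ^ k / 2) := by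
  have h := abs_sub_lt_of_capBump_ne_zero (capHeight_ne_zero i) hp
  cases i with
  | zero =>
    left
    rw [capHeight, abs_of_neg (by norm_num : (-1 / 4 : ℝ) < 0), abs_lt] at h
    exact ⟨rfl, by linarith, by linarith⟩
  | succ k =>
    right
    have hk : (0 : ℝ) < (1 / 4) ^ k := by positivity
    rw [capHeight, abs_of_pos (a := 3 / 8 * ((1 : ℝ) / 4) ^ k) (by positivity), abs_lt] at h
    exact ⟨k, rfl, by rw [pow_succ]; linarith, by linarith⟩

theorem ramp_nonneg (i : ℕ) (z : ℝ) : 0 ≤ ramp i z := by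
  cases i <;> exact Real.smoothTransition.nonneg _

theorem ramp_le_one (i : ℕ) (z : ℝ) : ramp i z ≤ 1 := by
  cases i <;> exact Real.smoothTransition.le_one _

theorem contDiff_ramp (i : ℕ) : ContDiff ℝ ∞ (ramp i) := by
  cases i <;> unfold ramp <;> exact Real.smoothTransition.contDiff.comp (by fun_prop)

theorem ramp_zero_eq_zero {z : ℝ} (hz : -1 / 2 ≤ z) : ramp 0 z = 0 :=
  Real.smoothTransition.zero_of_nonpos (by linarith)

theorem ramp_succ_eq_zero {k : ℕ} {z : ℝ} (hz : z ≤ (1 / 4) ^ k / 2) : ramp (k + 1) z = 0 := by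
  refine Real.smoothTransition.zero_of_nonpos ?_
  have : (2 : ℝ) * 4 ^ k * z ≤ 2 * 4 ^ k * ((1 / 4) ^ k / 2) := by gcongr
  have h4 : (4 : ℝ) ^ k * (1 / 4) ^ k = 1 := by rw [← mul_pow]; norm_num
  linarith

theorem ramp_succ_eq_one {k : ℕ} {z : ℝ} (hz : (1 / 4) ^ k ≤ z) : ramp (k + 1) z = 1 := by
  refine Real.smoothTransition.one_of_one_le ?_
  have : (2 : ℝ) * 4 ^ k * (1 / 4) ^ k ≤ 2 * 4 ^ k * z := by gcongr
  have h4 : (4 : ℝ) ^ k * (1 / 4) ^ k = 1 := by rw [← mul_pow]; norm_num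
  linarith

theorem tendsto_tailSum (η : ℕ → ℝ) : Tendsto (tailSum η) atTop (𝓝 0) :=
  (tendsto_sum_nat_add η).comp (tendsto_add_atTop_nat 1)

theorem norm_mul_ramp_le (η : ℕ → ℝ) (i : ℕ) (z : ℝ) : ‖η i * ramp i z‖ ≤ ‖η i‖ := by
  rw [norm_mul, Real.norm_of_nonneg (ramp_nonneg i z)]
  exact mul_le_of_le_one_right (norm_nonneg _) (ramp_le_one i z)

theorem spine_eq_zero (η : ℕ → ℝ) {z : ℝ} (hz : z ∈ Icc (-1 / 2 : ℝ) 0) : spine η z = 0 := by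
  rw [spine, tsum_congr (g := fun _ => (0 : ℝ)) fun i => ?_, tsum_zero]
  cases i with
  | zero => rw [ramp_zero_eq_zero hz.1, mul_zero]
  | succ j => rw [ramp_succ_eq_zero (hz.2.trans (by positivity)), mul_zero]

theorem norm_mul_capBump_le (η : ℕ → ℝ) (i : ℕ) (p : EuclideanSpace ℝ (Fin 3)) :
    ‖η i * capBump (capHeight i) p‖ ≤ ‖η i‖ := by
  rw [norm_mul, Real.norm_of_nonneg (capBump_nonneg _ p)]
  exact mul_le_of_le_one_right (norm_nonneg _) (capBump_le_one _ p)

namespace IsToothLength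

variable {η : ℕ → ℝ} (hη : IsToothLength η)
include hη

theorem summable_tail (k : ℕ) : Summable fun j => η (j + k + 1) :=
  (summable_nat_add_iff (k + 1)).2 hη.summable

theorem tailSum_sub_tailSum_succ (k : ℕ) : tailSum η k - tailSum η (k + 1) = η (k + 1) := by
  rw [tailSum, (hη.summable_tail k).tsum_eq_zero_add, tailSum, Nat.zero_add,
    tsum_congr fun j => by rw [show j + 1 + k + 1 = j + (k + 1) + 1 by ring]]
  ring

theorem strictAnti_tailSum : StrictAnti (tailSum η) :=
  strictAnti_nat_of_succ_lt fun k => by linarith [hη.tailSum_sub_tailSum_succ k, hη.pos k]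

theorem tailSum_pos (k : ℕ) : 0 < tailSum η k :=
  hη.strictAnti_tailSum.pos_of_tendsto_zero (tendsto_tailSum η) k

theorem zero_neg : η 0 < 0 := by
  rw [hη.balance]
  exact neg_neg_of_pos (hη.tailSum_pos 0)

theorem ne_zero (i : ℕ) : η i ≠ 0 := by
  cases i with
  | zero => exact hη.zero_neg.ne
  | succ k => exact (hη.pos k).ne'

theorem plateau_injective : Function.Injective (plateau η) := by
  intro i j h
  cases i <;> cases j <;> simp only [plateau] at h
  · rfl
  · exact absurd h (hη.tailSum_pos _).ne
  · exact absurd h (hη.tailSum_pos _).ne'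
  · exact hη.strictAnti_tailSum.injective h

/-! ### The spine of the function on the sphere -/

theorem summable_spine (z : ℝ) : Summable fun i => η i * ramp i z :=
  hη.summable.norm.of_norm_bounded fun i => norm_mul_ramp_le η i z

theorem continuous_spine : Continuous (spine η) :=
  continuous_tsum (fun i => continuous_const.mul (contDiff_ramp i).continuous)
    hη.summable.norm (norm_mul_ramp_le η)

theorem monotone_spine : Monotone (spine η) := by
  intro y z hyz
  refine (hη.summable_spine y).tsum_le_tsum (fun i => ?_) (hη.summable_spine z)
  cases i with
  | zero =>
    refine mul_le_mul_of_nonpos_left (Real.smoothTransition.monotone ?_) hη.zero_neg.le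
    linarith
  | succ k =>
    refine mul_le_mul_of_nonneg_left (Real.smoothTransition.monotone ?_) (hη.pos k).le
    gcongr

theorem spine_eq_tailSum {k : ℕ} {z : ℝ} (hz : (1 / 4) ^ k ≤ z)
    (hz' : ∀ j < k, z ≤ (1 / 4) ^ j / 2) : spine η z = tailSum η k := by
  have hpow : (0 : ℝ) < (1 / 4) ^ k := by positivity
  rw [spine, ← (hη.summable_spine z).sum_add_tsum_nat_add (k + 1), Finset.sum_eq_zero, zero_add,
    tailSum]
  · refine tsum_congr fun j => ?_
    rw [← add_assoc, ramp_succ_eq_one, mul_one]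
    exact (pow_le_pow_of_le_one (by norm_num) (by norm_num) (Nat.le_add_left k j)).trans hz
  · intro i hi
    cases i with
    | zero => rw [ramp_zero_eq_zero (by linarith), mul_zero]
    | succ j =>
      rw [ramp_succ_eq_zero (hz' j (by simpa using hi)), mul_zero]

theorem spine_one : spine η 1 = tailSum η 0 :=
  hη.spine_eq_tailSum (by norm_num) (by simp)

theorem spine_neg_one : spine η (-1) = -tailSum η 0 := by
  rw [spine, tsum_eq_single 0, ← hη.balance]
  · rw [ramp, Real.smoothTransition.one_of_one_le (by norm_num), mul_one]
  · intro i hi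
    obtain ⟨j, rfl⟩ := Nat.exists_eq_succ_of_ne_zero hi
    have : (0 : ℝ) < (1 / 4) ^ j := by positivity
    rw [Nat.succ_eq_add_one, ramp_succ_eq_zero (by linarith), mul_zero]

/-- The spine is constant on the zone of a cap. -/
theorem spine_eq_plateau {i : ℕ} {p : EuclideanSpace ℝ (Fin 3)}
    (hp : capBump (capHeight i) p ≠ 0) : spine η (p 2) = plateau η i := by
  rcases capHeight_zone hp with ⟨rfl, hz⟩ | ⟨k, rfl, hz⟩
  · exact spine_eq_zero η hz
  · refine hη.spine_eq_tailSum hz.1 fun j hj => hz.2.trans ?_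
    have : ((1 : ℝ) / 4) ^ k ≤ (1 / 4) ^ j :=
      pow_le_pow_of_le_one (by norm_num) (by norm_num) (by omega)
    linarith

/-! ### The teeth of the function on the sphere -/

theorem summable_teeth (p : EuclideanSpace ℝ (Fin 3)) :
    Summable fun i => η i * capBump (capHeight i) p :=
  hη.summable.norm.of_norm_bounded fun i => norm_mul_capBump_le η i p

theorem continuous_teeth : Continuous (teeth η) :=
  continuous_tsum (fun _ => continuous_const.mul (contDiff_capBump _).continuous)
    hη.summable.norm (norm_mul_capBump_le η)

theorem teeth_eq {i : ℕ} {p : EuclideanSpace ℝ (Fin 3)} (hp : capBump (capHeight i) p ≠ 0) :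
    teeth η p = η i * capBump (capHeight i) p := by
  refine tsum_eq_single i fun j hj => ?_
  by_contra hne
  -- The plateaus of two caps containing `p` have the same value.
  refine hj (hη.plateau_injective ?_)
  rw [← hη.spine_eq_plateau hp, ← hη.spine_eq_plateau (right_ne_zero_of_mul hne)]

theorem teeth_eq_zero_iff {p : EuclideanSpace ℝ (Fin 3)} :
    teeth η p = 0 ↔ ∀ i, capBump (capHeight i) p = 0 := by
  refine ⟨fun h i => ?_, fun h => ?_⟩
  · by_contra hne
    rw [hη.teeth_eq hne] at h
    exact mul_ne_zero (hη.ne_zero i) hne h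
  · simp [teeth, h]

/-! ### The map onto the comb -/

theorem isPreconnected_fibre (c : ℝ × ℝ) :
    IsPreconnected ((fun p : Sphere2 => (spine η (p.1 2), teeth η p.1)) ⁻¹' {c}) := by
  obtain ⟨u, v⟩ := c
  by_cases hv : v = 0
  · -- A zone of the sphere without the caps.
    subst hv
    convert Sphere2.isPreconnected_zone_inter (J := spine η ⁻¹' {u})
      (A := {p | ∀ i, capBump (capHeight i) p.1 = 0})
      (ordConnected_singleton.preimage_mono hη.monotone_spine) ?_ ?_ using 1
    · ext p
      simp [hη.teeth_eq_zero_iff]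
    · intro p hp q h2 h0 i
      exact le_antisymm ((capBump_le_capBump (abs_capHeight_le i) h2 h0).trans_eq (hp i))
        (capBump_nonneg _ _)
    · exact fun p hp _ i =>
        capBump_eq_zero_of_nonpos (capHeight_ne_zero i) (abs_capHeight_le i) hp
  · -- A level set of a single cap bump.
    rcases eq_empty_or_nonempty
      ((fun p : Sphere2 => (spine η (p.1 2), teeth η p.1)) ⁻¹' {(u, v)}) with he | ⟨p, hp⟩
    · rw [he]
      exact isPreconnected_empty
    rw [mem_preimage, mem_singleton_iff, Prod.mk.injEq] at hp
    obtain ⟨hpu, hpv⟩ := hp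
    obtain ⟨i, hi⟩ : ∃ i, capBump (capHeight i) p.1 ≠ 0 := by
      by_contra! hall
      exact hv (hpv.symm.trans (hη.teeth_eq_zero_iff.2 hall))
    convert isPreconnected_capBump_level (abs_capHeight_le i) (capBump (capHeight i) p.1) using 1
    ext q
    simp only [mem_preimage, mem_singleton_iff, Prod.mk.injEq, mem_ofPred_eq]
    constructor
    · rintro ⟨hqu, hqv⟩
      obtain ⟨j, hj⟩ : ∃ j, capBump (capHeight j) q.1 ≠ 0 := by
        by_contra! hall
        exact hv (hqv.symm.trans (hη.teeth_eq_zero_iff.2 hall))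
      obtain rfl : i = j := hη.plateau_injective (by
        rw [← hη.spine_eq_plateau hi, ← hη.spine_eq_plateau hj, hpu, hqu])
      rw [hη.teeth_eq hj, ← hpv, hη.teeth_eq hi] at hqv
      exact mul_left_cancel₀ (hη.ne_zero i) hqv
    · intro hq
      have hj : capBump (capHeight i) q.1 ≠ 0 := hq ▸ hi
      rw [hη.spine_eq_plateau hj, hη.teeth_eq hj, hq, ← hη.teeth_eq hi, ← hη.spine_eq_plateau hi]
      exact ⟨hpu, hpv⟩

theorem range_eq_comb :
    range (fun p : Sphere2 => (spine η (p.1 2), teeth η p.1)) = comb (tailSum η) := by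
  have htooth : ∀ i w, w ∈ Ioc (0 : ℝ) 1 → (plateau η i, η i * w) ∈
      range (fun p : Sphere2 => (spine η (p.1 2), teeth η p.1)) := by
    intro i w hw
    obtain ⟨p, rfl⟩ := exists_capBump_eq (capHeight_ne_zero i) (abs_capHeight_le i)
      ⟨hw.1.le, hw.2⟩
    exact ⟨p, Prod.ext (hη.spine_eq_plateau hw.1.ne') (hη.teeth_eq hw.1.ne')⟩
  have hspine : ∀ u ∈ Icc (-tailSum η 0) (tailSum η 0), (u, (0 : ℝ)) ∈
      range (fun p : Sphere2 => (spine η (p.1 2), teeth η p.1)) := by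
    intro u hu
    rw [← hη.spine_neg_one, ← hη.spine_one] at hu
    obtain ⟨z, hz, rfl⟩ := intermediate_value_Icc (by norm_num) hη.continuous_spine.continuousOn hu
    refine ⟨Sphere2.mk (-√(1 - z ^ 2)) 0 z ?_, Prod.ext rfl (hη.teeth_eq_zero_iff.2 fun i => ?_)⟩
    · rw [neg_sq, Real.sq_sqrt (by nlinarith [hz.1, hz.2])]
      ring
    · exact capBump_eq_zero_of_nonpos (capHeight_ne_zero i) (abs_capHeight_le i)
        (neg_nonpos.2 (Real.sqrt_nonneg _))
  have h0 := hη.tailSum_pos 0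
  apply Subset.antisymm
  · rintro _ ⟨p, rfl⟩
    by_cases hall : ∀ i, capBump (capHeight i) p.1 = 0
    · have hz : p.1 2 ∈ Icc (-1 : ℝ) 1 := by
        have := p.sum_sq
        constructor <;> nlinarith [sq_nonneg (p.1 0), sq_nonneg (p.1 1)]
      refine Or.inl ⟨⟨?_, ?_⟩, hη.teeth_eq_zero_iff.2 hall⟩
      · exact hη.spine_neg_one.symm.trans_le (hη.monotone_spine hz.1)
      · exact (hη.monotone_spine hz.2).trans_eq hη.spine_one
    · push Not at hall
      obtain ⟨i, hi⟩ := hall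
      have hnn := capBump_nonneg (capHeight i) p.1
      have hle := capBump_le_one (capHeight i) p.1
      simp only [hη.spine_eq_plateau hi, hη.teeth_eq hi]
      cases i with
      | zero =>
        refine Or.inr (Or.inl ⟨rfl, ?_⟩)
        dsimp only
        rw [hη.balance]
        constructor <;> nlinarith
      | succ k =>
        refine Or.inr (Or.inr ⟨k, rfl, ?_⟩)
        rw [hη.tailSum_sub_tailSum_succ]
        have := hη.pos k
        dsimp only
        constructor <;> nlinarith
  · rintro ⟨u, v⟩ (⟨hu, hv⟩ | ⟨hu, hv⟩ | ⟨k, hu, hv⟩)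
    · obtain rfl : v = 0 := hv
      exact hspine u hu
    · obtain rfl : u = 0 := hu
      dsimp only at hv
      rcases hv.2.eq_or_lt with rfl | hlt
      · exact hspine 0 ⟨by linarith, h0.le⟩
      · have := htooth 0 (v / η 0) ⟨div_pos_of_neg_of_neg hlt hη.zero_neg, by
          rw [div_le_one_of_neg hη.zero_neg, hη.balance]; exact hv.1⟩
        rwa [mul_div_cancel₀ _ (hη.ne_zero 0)] at this
    · obtain rfl : u = tailSum η (k + 1) := hu
      rw [hη.tailSum_sub_tailSum_succ] at hv
      dsimp only at hv
      rcases hv.1.eq_or_lt with rfl | hlt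
      · exact hspine _ ⟨by linarith [hη.tailSum_pos (k + 1)],
          hη.strictAnti_tailSum.antitone (Nat.zero_le _)⟩
      · have := htooth (k + 1) (v / η (k + 1)) ⟨div_pos hlt (hη.pos k), by
          rw [div_le_one (hη.pos k)]; exact hv.2⟩
        rwa [mul_div_cancel₀ _ (hη.ne_zero _)] at this

theorem factorsThroughComb :
    FactorsThroughComb (fun p : Sphere2 => spine η (p.1 2) + teeth η p.1)
      (fun p : Sphere2 => (spine η (p.1 2), teeth η p.1)) (tailSum η) where
  strictAnti := hη.strictAnti_tailSum
  tendsto := tendsto_tailSum η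
  continuous := (hη.continuous_spine.comp (Sphere2.continuous_coord 2)).prodMk
    (hη.continuous_teeth.comp continuous_subtype_val)
  height _ := rfl
  isPreconnected_fibre := hη.isPreconnected_fibre
  range_eq := hη.range_eq_comb

end IsToothLength

/-! ### Smoothness -/

/-- Compactly supported smooth functions can be summed to a smooth function with coefficients which
tend to zero sufficiently fast: the `i`-th coefficient is chosen after the bounds on the derivatives
of order at most `i` of the `i`-th function. -/
theorem exists_summable_forall_contDiff_tsum {E : Type*} [NormedAddCommGroup E] [NormedSpace ℝ E]
    {f : ℕ → E → ℝ} (hf : ∀ i, ContDiff ℝ ∞ (f i)) (hc : ∀ i, HasCompactSupport (f i)) :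
    ∃ ε : ℕ → ℝ, (∀ i, 0 < ε i) ∧ Summable ε ∧ ∀ (η : ℕ → ℝ) (C : ℝ), (∀ i, |η i| ≤ C * ε i) →
      ContDiff ℝ ∞ fun x => ∑' i, η i * f i x := by
  have hbound : ∀ i n, ∃ M, ∀ x, ‖iteratedFDeriv ℝ n (f i) x‖ ≤ M := fun i n =>
    ((hc i).iteratedFDeriv n).exists_bound_of_continuous
      ((hf i).continuous_iteratedFDeriv (mod_cast le_top))
  choose M hM using hbound
  have hM0 : ∀ i n, 0 ≤ M i n := fun i n => (norm_nonneg _).trans (hM i n 0)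
  set N : ℕ → ℝ := fun i => 1 + ∑ n ∈ Finset.range (i + 1), M i n with hN
  have hN1 : ∀ i, 1 ≤ N i := fun i =>
    le_add_of_nonneg_right (Finset.sum_nonneg fun n _ => hM0 i n)
  have hMN : ∀ i n, n ≤ i → M i n ≤ N i := fun i n hn =>
    (Finset.single_le_sum (fun m _ => hM0 i m) (Finset.mem_range.2 (by omega))).trans
      (le_add_of_nonneg_left zero_le_one)
  have hNpos : ∀ i, 0 < N i := fun i => zero_lt_one.trans_le (hN1 i)
  refine ⟨fun i => (1 / 2) ^ i / N i, fun i => div_pos (by positivity) (hNpos i), ?_, ?_⟩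
  · refine summable_geometric_two.of_nonneg_of_le
      (fun i => (div_pos (by positivity) (hNpos i)).le) fun i => div_le_self (by positivity) (hN1 i)
  · intro η C hη
    refine contDiff_tsum_of_eventually (v := fun _ i => C * (1 / 2) ^ i)
      (fun i => contDiff_const.mul (hf i)) (fun _ _ => summable_geometric_two.mul_left C) ?_
    intro n _
    rw [Nat.cofinite_eq_atTop]
    filter_upwards [eventually_ge_atTop n] with i hi x
    have hsmul : (fun x => η i * f i x) = η i • f i := rfl
    rw [hsmul, iteratedFDeriv_const_smul_apply ((hf i).contDiffAt.of_le (mod_cast le_top)),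
      norm_smul, Real.norm_eq_abs]
    calc |η i| * ‖iteratedFDeriv ℝ n (f i) x‖ ≤ (C * ((1 / 2) ^ i / N i)) * N i :=
          mul_le_mul (hη i) ((hM i n x).trans (hMN i n hi)) (norm_nonneg _)
            ((abs_nonneg _).trans (hη i))
      _ = C * (1 / 2) ^ i := by field_simp [(hNpos i).ne']

/-- There are lengths of teeth with a given sum for which the height of the comb becomes a smooth
function near the unit ball. -/
theorem exists_isToothLength_contDiff {d : ℝ} (hd : 0 < d) :
    ∃ η, IsToothLength η ∧ tailSum η 0 = d ∧ ∃ f : EuclideanSpace ℝ (Fin 3) → ℝ,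
      ContDiff ℝ ∞ f ∧ ∀ p, ‖p‖ ≤ 2 → f p = spine η (p 2) + teeth η p := by
  -- The cutoff makes the terms of the series compactly supported.
  let χ : ContDiffBump (0 : EuclideanSpace ℝ (Fin 3)) := ⟨2, 3, by norm_num, by norm_num⟩
  have hcoord : ContDiff ℝ ∞ fun p : EuclideanSpace ℝ (Fin 3) => p 2 :=
    contDiff_piLp_apply 2
  obtain ⟨ε, hε, hεs, hsmooth⟩ := exists_summable_forall_contDiff_tsum
    (f := fun i p => χ p * (ramp i (p 2) + capBump (capHeight i) p))
    (fun i => χ.contDiff.mul (((contDiff_ramp i).comp hcoord).add (contDiff_capBump _)))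
    (fun i => χ.hasCompactSupport.mul_right)
  have hεs' : Summable fun j => ε (j + 1) := (summable_nat_add_iff 1).2 hεs
  set Z := ∑' j, ε (j + 1) with hZ
  have hZpos : 0 < Z := hεs'.tsum_pos (fun j => (hε _).le) 0 (hε _)
  set η : ℕ → ℝ := fun i => if i = 0 then -d else d / Z * ε i with hη
  have hsucc : ∀ k, η (k + 1) = d / Z * ε (k + 1) := fun k => if_neg k.succ_ne_zero
  have htail : tailSum η 0 = d := by
    simp only [tailSum, add_zero, hsucc]
    rw [tsum_mul_left, ← hZ, div_mul_cancel₀ _ hZpos.ne']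
  have hlen : IsToothLength η := by
    refine ⟨fun k => ?_, ?_, ?_⟩
    · rw [hsucc]
      have := hε (k + 1)
      positivity
    · refine (summable_nat_add_iff 1).1 ?_
      simp only [hsucc]
      exact hεs'.mul_left _
    · rw [htail]
      exact if_pos rfl
  refine ⟨η, hlen, htail, _, hsmooth η (d / ε 0 + d / Z) fun i => ?_, fun p hp => ?_⟩
  · have h0 := hε 0
    have hi := hε i
    rcases i with _ | k
    · rw [hη]
      simp only [if_true, abs_neg, abs_of_pos hd]
      rw [add_mul, div_mul_cancel₀ _ h0.ne']
      exact le_add_of_nonneg_right (by positivity)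
    · rw [hsucc, abs_of_pos (by positivity), add_mul]
      exact le_add_of_nonneg_left (by positivity)
  · have hχ : χ p = 1 := χ.one_of_mem_closedBall (by simpa using hp)
    simp only [hχ, one_mul, mul_add]
    exact (hlen.summable_spine _).tsum_add (hlen.summable_teeth p)

/-! ### Critical points -/

/-- Near the centre of a cap, the function is a constant plus a positive multiple of the cap
bump. -/
theorem IsToothLength.isLocalMax_capCenter {η : ℕ → ℝ} (hη : IsToothLength η)
    {f : EuclideanSpace ℝ (Fin 3) → ℝ}
    (hf : ∀ p, ‖p‖ ≤ 2 → f p = spine η (p 2) + teeth η p) (k : ℕ) :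
    IsLocalMax f (capCenter (capHeight (k + 1))) := by
  set c := capCenter (capHeight (k + 1)) with hc
  have hc1 : ‖c‖ = 1 := by
    simpa using capCenter_mem_sphere (abs_capHeight_le (k + 1))
  have hcap : capBump (capHeight (k + 1)) c = 1 := capBump_capCenter _
  have hnear : ∀ᶠ p in 𝓝 c, ‖p‖ < 2 :=
    continuous_norm.tendsto c |>.eventually_lt_const (by rw [hc1]; norm_num)
  have hpos : ∀ᶠ p in 𝓝 c, 0 < capBump (capHeight (k + 1)) p :=
    (contDiff_capBump _).continuous.tendsto c |>.eventually_const_lt (by rw [hcap]; norm_num)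
  filter_upwards [hnear, hpos] with p hp hp0
  have hc0 : capBump (capHeight (k + 1)) c ≠ 0 := by rw [hcap]; norm_num
  rw [hf p hp.le, hf c (by rw [hc1]; norm_num), hη.spine_eq_plateau hp0.ne',
    hη.spine_eq_plateau hc0, hη.teeth_eq hp0.ne', hη.teeth_eq hc0, hcap]
  have := mul_le_mul_of_nonneg_left (capBump_le_one (capHeight (k + 1)) p) (hη.pos k).le
  linarith

theorem mfderiv_restrict_sphere_eq_zero {f : EuclideanSpace ℝ (Fin 3) → ℝ} (hf : ContDiff ℝ ∞ f)
    {p : Sphere2} (hp : fderiv ℝ f p.1 = 0) :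
    mfderiv (𝓡 2) 𝓘(ℝ, ℝ) (fun q : Sphere2 => f q.1) p = 0 := by
  have h1 : MDifferentiableAt 𝓘(ℝ, EuclideanSpace ℝ (Fin 3)) 𝓘(ℝ, ℝ) f p.1 :=
    (hf.differentiable (by simp)).mdifferentiable p.1
  have h2 : MDifferentiableAt (𝓡 2) 𝓘(ℝ, EuclideanSpace ℝ (Fin 3))
      ((↑) : Sphere2 → EuclideanSpace ℝ (Fin 3)) p :=
    (contMDiff_coe_sphere (m := ∞)).mdifferentiable (by simp) p
  have := mfderiv_comp p h1 h2
  rw [mfderiv_eq_fderiv, hp] at this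
  exact this.trans (ContinuousLinearMap.zero_comp _)

theorem continuous_capCenter : Continuous capCenter := by
  refine (PiLp.continuous_toLp 2 _).comp (continuous_pi fun i => ?_)
  fin_cases i
  · exact (continuous_const.sub (continuous_pow 2)).sqrt
  · exact continuous_const
  · exact continuous_id

theorem tendsto_capHeight : Tendsto (fun k => capHeight (k + 1)) atTop (𝓝 0) := by
  simpa [capHeight] using (tendsto_pow_atTop_nhds_zero_of_lt_one (r := (1 / 4 : ℝ))
    (by norm_num) (by norm_num)).const_mul (3 / 8)

theorem mainTheorem4 (d₁ : ℝ) (hd₁ : 0 < d₁) :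
    ∃ F : Sphere2 → ℝ, ContMDiff (𝓡 2) 𝓘(ℝ, ℝ) ∞ F ∧
      Set.range F = Set.Icc (-d₁) d₁ ∧
      (∀ t ∈ Set.Icc (-d₁) d₁, t ≠ 0 → Nat.card (ConnectedComponents (F ⁻¹' {t})) = 2) ∧
      IsConnected (F ⁻¹' {0}) ∧
      IsDendrite (ReebSpace F) ∧
      ¬ HasFiniteGraphStructure (ReebSpace F) ∧
      ¬ DiscreteTopology (topologicalVertices (ReebSpace F)) ∧
      ¬ DiscreteTopology (criticalContours F) := by
  obtain ⟨η, hη, htail, f, hf, hfη⟩ := exists_isToothLength_contDiff hd₁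
  have hF : (fun p : Sphere2 => f p.1) = fun p : Sphere2 => spine η (p.1 2) + teeth η p.1 :=
    funext fun p => hfη p.1 (by rw [norm_eq_of_mem_sphere p]; norm_num)
  have hcomb := hη.factorsThroughComb
  rw [← hF] at hcomb
  -- The centres of the caps, which lie over the tips of the teeth, and their limit.
  let x : ℕ → Sphere2 := fun k =>
    ⟨capCenter (capHeight (k + 1)), capCenter_mem_sphere (abs_capHeight_le _)⟩
  let a : Sphere2 := ⟨capCenter 0, capCenter_mem_sphere (by norm_num)⟩
  have hlim : Tendsto (fun k => capCenter (capHeight (k + 1))) atTop (𝓝 (capCenter 0)) :=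
    (continuous_capCenter.tendsto 0).comp tendsto_capHeight
  have hxa : Tendsto x atTop (𝓝 a) := tendsto_subtype_rng.2 hlim
  have hx : ∀ k, (spine η ((x k).1 2), teeth η (x k).1) =
      (tailSum η (k + 1), tailSum η k - tailSum η (k + 1)) := by
    intro k
    have h1 : capBump (capHeight (k + 1)) (x k).1 = 1 := capBump_capCenter _
    have h0 : capBump (capHeight (k + 1)) (x k).1 ≠ 0 := by rw [h1]; exact one_ne_zero
    rw [hη.spine_eq_plateau h0, hη.teeth_eq h0, h1, mul_one, hη.tailSum_sub_tailSum_succ]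
    rfl
  have hcrit : ∀ k, fderiv ℝ f (x k).1 = 0 := fun k =>
    (hη.isLocalMax_capCenter hfη k).fderiv_eq_zero
  have hcrita : fderiv ℝ f a.1 = 0 := by
    refine tendsto_nhds_unique
      (((hf.continuous_fderiv (by simp)).tendsto (capCenter 0)).comp hlim) ?_
    exact tendsto_const_nhds.congr fun k => (hcrit k).symm
  have hvert : ∀ k, reebQuotientMap (fun p : Sphere2 => f p.1) (x k) ∈
      topologicalVertices (ReebSpace fun p : Sphere2 => f p.1) := fun k =>
    hcomb.tip_mem_topologicalVertices (hx k)
  refine ⟨fun p => f p.1, hf.contMDiff.comp contMDiff_coe_sphere, ?_, ?_,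
    hcomb.isConnected_zero_level, hcomb.isDendrite, hcomb.not_hasFiniteGraphStructure, ?_, ?_⟩
  · rw [hcomb.range_height, htail]
  · intro t ht
    rw [← htail] at ht
    exact hcomb.card_components ht
  · refine hcomb.not_discreteTopology_of_tips hxa hx hvert ?_
    exact (isClosed_topologicalVertices _).mem_of_tendsto
      ((continuous_quotient_mk'.tendsto a).comp hxa) (Eventually.of_forall hvert)
  · exact hcomb.not_discreteTopology_of_tips hxa hx
      (fun k => ⟨x k, mfderiv_restrict_sphere_eq_zero hf (hcrit k), rfl⟩)
      ⟨a, mfderiv_restrict_sphere_eq_zero hf hcrita, rfl⟩
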